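/- Let $d\ge 2$ and let $\Omega\subset\mathbb R^d$ be a bounded connected open set with $C^{1,1}$ boundary, $\partial\Omega=\overline{\Gamma_N}\cup\overline{\Gamma_D}$ with $\Gamma_N,\Gamma_D$ nonempty, disjoint and relatively open in $\partial\Omega$. Fix $0<\alpha_1\le\alpha_2$ and $0<\beta_1\le\beta_2$. For $j=1,2$ let $\lambda_j\in L^\infty(\Omega)$ and $\mu_j\in C^{0,1}(\Omega)$ satisfy $\alpha_1\le\lambda_j\le\alpha_2$ and $\beta_1\le\mu_j\le\beta_2$ in $\Omega$, and let $\mathbb C_j=\mathbb C(\lambda_j,\mu_j)$, where $\mathbb C(\lambda,\mu)_{ikmn}=\lambda\,\delta_{ik}\delta_{mn}+\mu(\delta_{im}\delta_{kn}+\delta_{in}\delta_{km})$. Write $\hat\nabla u=\tfrac12(\nabla u+(\nabla u)^T)$, $A:B=\sum_{i,k}a_{ik}b_{ik}$, and $\mathcal V=\{v\in H^1(\Omega)^d: v|_{\Gamma_D}=0\}$. For a load $g\in L^2(\Gamma_N)^d$ the corresponding solution $u=u^g_{\mathbb C}\in\mathcal V$ is the weak solution of $-\operatorname{div}(\mathbb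 C\hat\nabla u)=0$ in $\Omega$, $(\mathbb C\hat\nabla u)\nu=g$ on $\Gamma_N$, $u=0$ on $\Gamma_D$, that is, $$\int_\Omega\mathbb C\hat\nabla u:\hat\nabla v\,dx=\int_{\Gamma_N}g\cdot v\,ds\qquad\text{for all }v\in\mathcal V,$$ and the Neumann-to-Dirichlet operator is $\Lambda(\mathbb C):L^2(\Gamma_N)^d\to L^2(\Gamma_N)^d$, $g\mapsto u^g_{\mathbb C}|_{\Gamma_N}$. Let $\langle\cdot,\cdot\rangle$ be the inner product of $L^2(\Gamma_N)^d$. Let $g\in L^2(\Gamma_N)^d$, and let $u_1,u_2\in\mathcal V$ be the corresponding weak solutions for $\mathbb C_1$ and $\mathbb C_2$. Then $$\int_\Omega(\mathbb C_1-\mathbb C_2)\hat\nabla u_2:\hat\nabla u_2\,dx\ \ge\ \langle g,\Lambda(\mathbb C_2)g\rangle-\langle g,\Lambda(\mathbb C_1)g\rangle\ \ge\ \int_\Omega(\mathbb C_1-\mathbb C_2)\hat\nabla u_1:\hat\nabla u_1\,dx .$$ Moreover, if $\lambda_1\le\lambda_2$ and $\mu_1\le\mu_2$ in $\Omega$, then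 $\Lambda(\mathbb C_1)\ge\Lambda(\mathbb C_2)$ in the sense of quadratic forms, that is, $\langle g,\Lambda(\mathbb C_1)g\rangle\ge\langle g,\Lambda(\mathbb C_2)g\rangle$ for all such $g$. -/

import Mathlib

open MeasureTheory Filter Topology
open scoped ContDiff ENNReal NNReal

noncomputable section

namespace LinElast

/-- The physical space `ℝᵈ` with its Euclidean norm. -/
abbrev Space (d : ℕ) := EuclideanSpace ℝ (Fin d)

/-- `Ω` has a `C^{1,1}` boundary: near each boundary point, in a suitable Cartesian coordinate
system whose last axis is spanned by the unit vector `e`, the set `Ω` is the strict epigraph of a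
`C¹` function with Lipschitz gradient of the remaining coordinates `x - ⟪e, x⟫ e`. -/
def HasC11Boundary {d : ℕ} (Ω : Set (Space d)) : Prop :=
  ∀ x₀ ∈ frontier Ω, ∃ e : Space d, ‖e‖ = 1 ∧ ∃ γ : Space d → ℝ,
    ContDiff ℝ 1 γ ∧ (∃ K : ℝ≥0, LipschitzWith K (fderiv ℝ γ)) ∧
    ∃ r : ℝ, 0 < r ∧ ∀ x ∈ Metric.ball x₀ r,
      (x ∈ Ω ↔ γ (x - inner ℝ e x • e) < inner ℝ e x)

/-- `Γ` is an open part of the boundary of `Ω` (in the relative topology of the boundary). -/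
def IsOpenBoundaryPart {d : ℕ} (Ω Γ : Set (Space d)) : Prop :=
  ∃ U : Set (Space d), IsOpen U ∧ Γ = U ∩ frontier Ω

/-- The geometric setting: a bounded connected open set with `C^{1,1}` boundary, the boundary being
split into the nonempty disjoint open parts `ΓD` (Dirichlet part) and `ΓN` (Neumann part). -/
structure IsElasticBody {d : ℕ} (Ω ΓD ΓN : Set (Space d)) : Prop where
  isOpen : IsOpen Ω
  isConnected : IsConnected Ω
  isBounded : Bornology.IsBounded Ω
  boundary : HasC11Boundary Ω
  dirichlet_open : IsOpenBoundaryPart Ω ΓD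
  neumann_open : IsOpenBoundaryPart Ω ΓN
  dirichlet_nonempty : ΓD.Nonempty
  neumann_nonempty : ΓN.Nonempty
  disjoint : Disjoint ΓN ΓD
  cover : frontier Ω = closure ΓN ∪ closure ΓD

/-! ### Sobolev space, traces -/

/-- An element `u` of `H¹(Ω)ᵈ`, given by a representative together with a representative of its
weak gradient, `grad x i j = ∂u_i/∂x_j (x)`. -/
structure H1Field {d : ℕ} (Ω : Set (Space d)) where
  val : Space d → Space d
  grad : Space d → Matrix (Fin d) (Fin d) ℝ
  memLp_val : MemLp val 2 (volume.restrict Ω)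
  memLp_grad : ∀ i j, MemLp (fun x => grad x i j) 2 (volume.restrict Ω)
  weak_deriv : ∀ i j, ∀ φ : Space d → ℝ, ContDiff ℝ ∞ φ → HasCompactSupport φ → tsupport φ ⊆ Ω →
    ∫ x in Ω, val x i * fderiv ℝ φ x (EuclideanSpace.single j 1) = - ∫ x in Ω, grad x i j * φ x

/-- The surface measure on a boundary part `Γ`: the `(d-1)`-dimensional Hausdorff measure,
normalized so that it is the usual hypersurface area. -/
def surface {d : ℕ} (Γ : Set (Space d)) : Measure (Space d) :=
  (μHE[d - 1] : Measure (Space d)).restrict Γ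

/-- The space `L²(Γ)ᵈ` of vector fields on a boundary part. -/
abbrev BoundaryL2 {d : ℕ} (Γ : Set (Space d)) := Lp (Space d) 2 (surface Γ)

/-- `h` is the trace of `u ∈ H¹(Ω)ᵈ` on `Γ ⊆ ∂Ω`: there are fields `φₙ`, smooth up to the boundary,
with `φₙ → u` in `H¹(Ω)ᵈ` and `φₙ → h` in `L²(Γ)ᵈ`. -/
def HasTrace {d : ℕ} {Ω : Set (Space d)} (Γ : Set (Space d)) (u : H1Field Ω)
    (h : BoundaryL2 Γ) : Prop :=
  ∃ φ : ℕ → Space d → Space d, (∀ n, ContDiff ℝ ∞ (φ n)) ∧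
    Tendsto (fun n => eLpNorm (fun x => φ n x - u.val x) 2 (volume.restrict Ω)) atTop (𝓝 0) ∧
    (∀ i j, Tendsto (fun n => eLpNorm
      (fun x => fderiv ℝ (φ n) x (EuclideanSpace.single j 1) i - u.grad x i j) 2
      (volume.restrict Ω)) atTop (𝓝 0)) ∧
    Tendsto (fun n => eLpNorm (fun x => φ n x - h x) 2 (surface Γ)) atTop (𝓝 0)

open Classical in
/-- The trace `u|_Γ ∈ L²(Γ)ᵈ`. On the bounded `C^{1,1}` domains considered here it exists and is
unique for every `u ∈ H¹(Ω)ᵈ`. -/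
def boundaryTrace {d : ℕ} {Ω : Set (Space d)} (Γ : Set (Space d)) (u : H1Field Ω) :
    BoundaryL2 Γ :=
  if h : ∃ t, HasTrace Γ u t then h.choose else 0

/-- The space `𝒱` of fields in `H¹(Ω)ᵈ` with vanishing trace on `ΓD`. -/
def displacementSpace {d : ℕ} (Ω ΓD : Set (Space d)) : Set (H1Field Ω) :=
  {v | HasTrace ΓD v 0}

/-- The linearized strain `½ (∇u + (∇u)ᵀ)`. -/
def strain {d : ℕ} {Ω : Set (Space d)} (u : H1Field Ω) (x : Space d) :
    Matrix (Fin d) (Fin d) ℝ :=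
  (1 / 2 : ℝ) • (u.grad x + (u.grad x).transpose)

/-! ### Elastic tensors -/

/-- Tensors of order four. -/
abbrev Tensor4 (d : ℕ) := Fin d → Fin d → Fin d → Fin d → ℝ

/-- The isotropic elastic tensor field `ℂ(λ, μ)` with Lamé parameters `λ = lam`, `μ = mu`. -/
def isotropic {d : ℕ} (lam mu : Space d → ℝ) : Space d → Tensor4 d := fun x i j k l =>
  lam x * ((if i = j then 1 else 0) * (if k = l then 1 else 0)) +
    mu x * ((if i = k then 1 else 0) * (if j = l then 1 else 0) +
      (if i = l then 1 else 0) * (if j = k then 1 else 0))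

/-- The action of a tensor of order four on a matrix, `(ℂA)_{ij} = ∑_{k,l} ℂ_{ijkl} A_{kl}`. -/
def Tensor4.act {d : ℕ} (C : Tensor4 d) (A : Matrix (Fin d) (Fin d) ℝ) :
    Matrix (Fin d) (Fin d) ℝ :=
  Matrix.of fun i j => ∑ k, ∑ l, C i j k l * A k l

/-- The product `A : B = ∑_{i,j} a_{ij} b_{ij}`. -/
def frob {d : ℕ} (A B : Matrix (Fin d) (Fin d) ℝ) : ℝ := ∑ i, ∑ j, A i j * B i j

/-- The energy form `∫_Ω ℂ ∇̂u : ∇̂v dx`. -/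
def energy {d : ℕ} {Ω : Set (Space d)} (C : Space d → Tensor4 d) (u v : H1Field Ω) : ℝ :=
  ∫ x in Ω, frob ((C x).act (strain u x)) (strain v x)

/-- Admissible Lamé parameters: `λ ∈ L^∞(Ω)`, `μ ∈ C^{0,1}(Ω)` with `α₁ ≤ λ ≤ α₂` and
`β₁ ≤ μ ≤ β₂`. -/
structure IsAdmissible {d : ℕ} (Ω : Set (Space d)) (α₁ α₂ β₁ β₂ : ℝ) (lam mu : Space d → ℝ) :
    Prop where
  memLp : MemLp lam ∞ (volume.restrict Ω)
  lipschitz : ∃ K : ℝ≥0, LipschitzOnWith K mu Ω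
  lam_bounds : ∀ᵐ x ∂(volume.restrict Ω), α₁ ≤ lam x ∧ lam x ≤ α₂
  mu_bounds : ∀ x ∈ Ω, β₁ ≤ mu x ∧ mu x ≤ β₂

/-! ### The boundary value problem and the Neumann-to-Dirichlet operator -/

/-- `u ∈ 𝒱` is the (weak) solution of `-div(ℂ∇̂u) = 0` in `Ω`, `(ℂ∇̂u)ν = g` on `ΓN`, `u = 0` on
`ΓD`, that is, `∫_Ω ℂ∇̂u : ∇̂v dx = ∫_{ΓN} g · v ds` for all `v ∈ 𝒱`. -/
def IsWeakSolution {d : ℕ} {Ω : Set (Space d)} (ΓD ΓN : Set (Space d)) (C : Space d → Tensor4 d)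
    (g : BoundaryL2 ΓN) (u : H1Field Ω) : Prop :=
  u ∈ displacementSpace Ω ΓD ∧
    ∀ v ∈ displacementSpace Ω ΓD, energy C u v = inner ℝ g (boundaryTrace ΓN v)

open Classical in
/-- The Neumann-to-Dirichlet operator `Λ(ℂ) : L²(ΓN)ᵈ → L²(ΓN)ᵈ`, mapping a load `g` to the trace on
`ΓN` of the weak solution with load `g`. -/
def neumannToDirichlet {d : ℕ} (Ω ΓD ΓN : Set (Space d)) (C : Space d → Tensor4 d)
    (g : BoundaryL2 ΓN) : BoundaryL2 ΓN :=
  if h : ∃ u : H1Field Ω, IsWeakSolution ΓD ΓN C g u then boundaryTrace ΓN h.choose else 0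

end LinElast

end

/-!
The weak formulation alone gives the energy comparison. Write `E j` for the energy form of `ℂⱼ`; it
is symmetric, and positive semidefinite since the Lamé parameters are positive. Testing the two weak
formulations with `u₁` and `u₂` gives
`E 1 u₁ u₁ = ⟪g, u₁⟫ = E 2 u₂ u₁` and `E 2 u₂ u₂ = ⟪g, u₂⟫ = E 1 u₁ u₂`. Expanding
`0 ≤ E 1 (u₁ - u₂) (u₁ - u₂)` then yields
`⟪g, u₂⟫ - ⟪g, u₁⟫ ≤ E 1 u₂ u₂ - E 2 u₂ u₂` (`inner_trace_sub_le_energy_sub`), which is the first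
inequality. Exchanging the two bodies gives the second one, and the monotonicity follows from the
first because `ℂ₁ - ℂ₂` is then negative semidefinite.

The Neumann-to-Dirichlet operator is defined through a choice of weak solution. The same symmetry
argument shows that `⟪g, ·⟫` takes the same value on the traces of all weak solutions with load `g`
(`inner_neumannToDirichlet`), so neither uniqueness of the solution nor the trace theorem is needed.
-/

namespace LinElast

variable {d : ℕ} {Ω ΓD ΓN : Set (Space d)}

lemma strain_comm (u : H1Field Ω) (x : Space d) (i j : Fin d) :
    strain u x i j = strain u x j i := by
  simp [strain, add_comm]

lemma frob_comm (A B : Matrix (Fin d) (Fin d) ℝ) : frob A B = frob B A := by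
  simp [frob, mul_comm]

lemma frob_self_nonneg (A : Matrix (Fin d) (Fin d) ℝ) : 0 ≤ frob A A :=
  Finset.sum_nonneg fun _ _ => Finset.sum_nonneg fun _ _ => mul_self_nonneg _

lemma frob_sub_sub (A B : Matrix (Fin d) (Fin d) ℝ) :
    frob (A - B) (A - B) = frob A A - 2 * frob A B + frob B B := by
  simp only [frob, Matrix.sub_apply, Finset.mul_sum, ← Finset.sum_sub_distrib,
    ← Finset.sum_add_distrib]
  exact Finset.sum_congr rfl fun i _ => Finset.sum_congr rfl fun j _ => by ring

lemma isotropic_act_apply (lam mu : Space d → ℝ) (x : Space d) (A : Matrix (Fin d) (Fin d) ℝ)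
    (i j : Fin d) :
    (isotropic lam mu x).act A i j =
      lam x * ((if i = j then 1 else 0) * A.trace) + mu x * (A i j + A j i) := by
  simp only [Tensor4.act, isotropic, Matrix.of_apply, add_mul, mul_add, Finset.sum_add_distrib,
    Matrix.trace, Matrix.diag]
  simp [Finset.mul_sum]

/-- Hooke's law for an isotropic tensor: `ℂA : B = λ tr A tr B + 2μ A : B` for symmetric `A`. -/
lemma frob_isotropic_act (lam mu : Space d → ℝ) (x : Space d) {A : Matrix (Fin d) (Fin d) ℝ}
    (hA : ∀ i j, A i j = A j i) (B : Matrix (Fin d) (Fin d) ℝ) :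
    frob ((isotropic lam mu x).act A) B =
      lam x * (A.trace * B.trace) + mu x * (2 * frob A B) := by
  have h : ∀ i j, (isotropic lam mu x).act A i j * B i j =
      (if i = j then lam x * A.trace * B i j else 0) + mu x * (2 * (A i j * B i j)) := by
    intro i j
    rw [isotropic_act_apply, hA j i]
    split_ifs <;> ring
  simp only [frob, h, Finset.sum_add_distrib, ← Finset.mul_sum]
  simp [Matrix.trace, ← Finset.mul_sum, mul_assoc]

lemma energy_isotropic (lam mu : Space d → ℝ) (u v : H1Field Ω) :
    energy (isotropic lam mu) u v =
      ∫ x in Ω, (lam x * ((strain u x).trace * (strain v x).trace) +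
        mu x * (2 * frob (strain u x) (strain v x))) := by
  simp only [energy, frob_isotropic_act _ _ _ (strain_comm u _)]

lemma energy_isotropic_comm (lam mu : Space d → ℝ) (u v : H1Field Ω) :
    energy (isotropic lam mu) u v = energy (isotropic lam mu) v u := by
  simp only [energy_isotropic, frob_comm (strain u _), mul_comm (strain u _).trace]

lemma isotropic_sub (lam₁ mu₁ lam₂ mu₂ : Space d → ℝ) :
    isotropic lam₁ mu₁ - isotropic lam₂ mu₂ = isotropic (lam₁ - lam₂) (mu₁ - mu₂) := by
  funext x i j k l
  simp only [isotropic, Pi.sub_apply]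
  ring

lemma memLp_strain (u : H1Field Ω) (i j : Fin d) :
    MemLp (fun x => strain u x i j) 2 (volume.restrict Ω) := by
  simpa [strain] using ((u.memLp_grad i j).add (u.memLp_grad j i)).const_mul (1 / 2 : ℝ)

lemma integrable_energyDensity {lam mu : Space d → ℝ}
    (hlam : MemLp lam ∞ (volume.restrict Ω)) (hmu : MemLp mu ∞ (volume.restrict Ω))
    (u v : H1Field Ω) :
    Integrable (fun x => lam x * ((strain u x).trace * (strain v x).trace) +
      mu x * (2 * frob (strain u x) (strain v x))) (volume.restrict Ω) := by
  have htr (w : H1Field Ω) : MemLp (fun x => (strain w x).trace) 2 (volume.restrict Ω) :=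
    memLp_finsetSum _ fun i _ => memLp_strain w i i
  have hfrob : Integrable (fun x => frob (strain u x) (strain v x)) (volume.restrict Ω) :=
    integrable_finsetSum _ fun i _ => integrable_finsetSum _ fun j _ =>
      (memLp_strain u i j).integrable_mul (memLp_strain v i j)
  exact (((htr u).integrable_mul (htr v)).mul_of_top_right hlam).add
    ((hfrob.const_mul 2).mul_of_top_right hmu)

lemma energy_isotropic_sub {lam₁ mu₁ lam₂ mu₂ : Space d → ℝ}
    (hlam₁ : MemLp lam₁ ∞ (volume.restrict Ω)) (hmu₁ : MemLp mu₁ ∞ (volume.restrict Ω))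
    (hlam₂ : MemLp lam₂ ∞ (volume.restrict Ω)) (hmu₂ : MemLp mu₂ ∞ (volume.restrict Ω))
    (u v : H1Field Ω) :
    energy (isotropic lam₁ mu₁ - isotropic lam₂ mu₂) u v =
      energy (isotropic lam₁ mu₁) u v - energy (isotropic lam₂ mu₂) u v := by
  rw [isotropic_sub]
  simp only [energy_isotropic]
  rw [← integral_sub (integrable_energyDensity hlam₁ hmu₁ u v)
    (integrable_energyDensity hlam₂ hmu₂ u v)]
  congr 1 with x
  simp only [Pi.sub_apply]
  ring

lemma energy_self_mono {lam₁ mu₁ lam₂ mu₂ : Space d → ℝ}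
    (hlam₁ : MemLp lam₁ ∞ (volume.restrict Ω)) (hmu₁ : MemLp mu₁ ∞ (volume.restrict Ω))
    (hlam₂ : MemLp lam₂ ∞ (volume.restrict Ω)) (hmu₂ : MemLp mu₂ ∞ (volume.restrict Ω))
    (hlam : ∀ᵐ x ∂(volume.restrict Ω), lam₁ x ≤ lam₂ x)
    (hmu : ∀ᵐ x ∂(volume.restrict Ω), mu₁ x ≤ mu₂ x) (u : H1Field Ω) :
    energy (isotropic lam₁ mu₁) u u ≤ energy (isotropic lam₂ mu₂) u u := by
  simp only [energy_isotropic]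
  refine integral_mono_ae (integrable_energyDensity hlam₁ hmu₁ u u)
    (integrable_energyDensity hlam₂ hmu₂ u u) ?_
  filter_upwards [hlam, hmu] with x hx hx'
  exact add_le_add (mul_le_mul_of_nonneg_right hx (mul_self_nonneg _))
    (mul_le_mul_of_nonneg_right hx' (mul_nonneg zero_le_two (frob_self_nonneg _)))

/-- Positivity of the energy of `u - v`, in expanded form. -/
lemma energy_sub_two_mul_add_nonneg {lam mu : Space d → ℝ}
    (hlam : MemLp lam ∞ (volume.restrict Ω)) (hmu : MemLp mu ∞ (volume.restrict Ω))
    (hlam₀ : ∀ᵐ x ∂(volume.restrict Ω), 0 ≤ lam x)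
    (hmu₀ : ∀ᵐ x ∂(volume.restrict Ω), 0 ≤ mu x) (u v : H1Field Ω) :
    0 ≤ energy (isotropic lam mu) u u - 2 * energy (isotropic lam mu) u v +
      energy (isotropic lam mu) v v := by
  simp only [energy_isotropic]
  have huu := integrable_energyDensity hlam hmu u u
  have huv := integrable_energyDensity hlam hmu u v
  have hvv := integrable_energyDensity hlam hmu v v
  have hsub := huu.sub (huv.const_mul 2)
  simp only [Pi.sub_def] at hsub
  rw [← integral_const_mul, ← integral_sub huu (huv.const_mul 2), ← integral_add hsub hvv]
  refine integral_nonneg_of_ae ?_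
  filter_upwards [hlam₀, hmu₀] with x hx hx'
  have h₁ := mul_nonneg hx (mul_self_nonneg ((strain u x).trace - (strain v x).trace))
  have h₂ := mul_nonneg hx' (frob_self_nonneg (strain u x - strain v x))
  rw [frob_sub_sub] at h₂
  simp only [Pi.zero_apply]
  linarith

namespace IsAdmissible

variable {α₁ α₂ β₁ β₂ : ℝ} {lam mu : Space d → ℝ}

lemma memLp_mu (hΩ : IsOpen Ω) (h : IsAdmissible Ω α₁ α₂ β₁ β₂ lam mu) :
    MemLp mu ∞ (volume.restrict Ω) := by
  obtain ⟨K, hK⟩ := h.lipschitz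
  refine memLp_top_of_bound (hK.continuousOn.aestronglyMeasurable hΩ.measurableSet)
    (max |β₁| |β₂|) ?_
  filter_upwards [ae_restrict_mem hΩ.measurableSet] with x hx
  exact abs_le_max_abs_abs (h.mu_bounds x hx).1 (h.mu_bounds x hx).2

lemma lam_nonneg (hα₁ : 0 < α₁) (h : IsAdmissible Ω α₁ α₂ β₁ β₂ lam mu) :
    ∀ᵐ x ∂(volume.restrict Ω), 0 ≤ lam x :=
  h.lam_bounds.mono fun _ hx => hα₁.le.trans hx.1

lemma mu_nonneg (hΩ : IsOpen Ω) (hβ₁ : 0 < β₁) (h : IsAdmissible Ω α₁ α₂ β₁ β₂ lam mu) :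
    ∀ᵐ x ∂(volume.restrict Ω), 0 ≤ mu x :=
  (ae_restrict_mem hΩ.measurableSet).mono fun x hx => hβ₁.le.trans (h.mu_bounds x hx).1

end IsAdmissible

/-- The value `⟪g, Λ(ℂ)g⟫` may be computed with any weak solution for the load `g`. -/
lemma inner_neumannToDirichlet {lam mu : Space d → ℝ} {g : BoundaryL2 ΓN} {u : H1Field Ω}
    (hu : IsWeakSolution ΓD ΓN (isotropic lam mu) g u) :
    inner ℝ g (neumannToDirichlet Ω ΓD ΓN (isotropic lam mu) g) =
      inner ℝ g (boundaryTrace ΓN u) := by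
  have hex : ∃ w : H1Field Ω, IsWeakSolution ΓD ΓN (isotropic lam mu) g w := ⟨u, hu⟩
  rw [neumannToDirichlet, dif_pos hex, ← hu.2 _ hex.choose_spec.1, energy_isotropic_comm,
    hex.choose_spec.2 u hu.1]

lemma inner_trace_sub_le_energy_sub {lam₁ mu₁ lam₂ mu₂ : Space d → ℝ}
    (hlam₁ : MemLp lam₁ ∞ (volume.restrict Ω)) (hmu₁ : MemLp mu₁ ∞ (volume.restrict Ω))
    (hlam₀ : ∀ᵐ x ∂(volume.restrict Ω), 0 ≤ lam₁ x)
    (hmu₀ : ∀ᵐ x ∂(volume.restrict Ω), 0 ≤ mu₁ x)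
    {g : BoundaryL2 ΓN} {u₁ u₂ : H1Field Ω}
    (hu₁ : IsWeakSolution ΓD ΓN (isotropic lam₁ mu₁) g u₁)
    (hu₂ : IsWeakSolution ΓD ΓN (isotropic lam₂ mu₂) g u₂) :
    inner ℝ g (boundaryTrace ΓN u₂) - inner ℝ g (boundaryTrace ΓN u₁) ≤
      energy (isotropic lam₁ mu₁) u₂ u₂ - energy (isotropic lam₂ mu₂) u₂ u₂ := by
  have h := energy_sub_two_mul_add_nonneg hlam₁ hmu₁ hlam₀ hmu₀ u₁ u₂
  rw [hu₁.2 u₁ hu₁.1, hu₁.2 u₂ hu₂.1] at h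
  rw [hu₂.2 u₂ hu₂.1]
  linarith

end LinElast

open LinElast in
theorem lemma3p1 {d : ℕ} (hd : 2 ≤ d) (Ω ΓD ΓN : Set (Space d)) (hΩ : IsElasticBody Ω ΓD ΓN)
    (α₁ α₂ β₁ β₂ : ℝ) (hα₁ : 0 < α₁) (hα : α₁ ≤ α₂) (hβ₁ : 0 < β₁) (hβ : β₁ ≤ β₂)
    (lam₁ mu₁ lam₂ mu₂ : Space d → ℝ)
    (h₁ : IsAdmissible Ω α₁ α₂ β₁ β₂ lam₁ mu₁) (h₂ : IsAdmissible Ω α₁ α₂ β₁ β₂ lam₂ mu₂)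
    (g : BoundaryL2 ΓN) (u₁ u₂ : H1Field Ω)
    (hu₁ : IsWeakSolution ΓD ΓN (isotropic lam₁ mu₁) g u₁)
    (hu₂ : IsWeakSolution ΓD ΓN (isotropic lam₂ mu₂) g u₂) :
    (energy (isotropic lam₁ mu₁ - isotropic lam₂ mu₂) u₂ u₂ ≥
        inner ℝ g (neumannToDirichlet Ω ΓD ΓN (isotropic lam₂ mu₂) g) -
          inner ℝ g (neumannToDirichlet Ω ΓD ΓN (isotropic lam₁ mu₁) g) ∧
      inner ℝ g (neumannToDirichlet Ω ΓD ΓN (isotropic lam₂ mu₂) g) -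
          inner ℝ g (neumannToDirichlet Ω ΓD ΓN (isotropic lam₁ mu₁) g) ≥
        energy (isotropic lam₁ mu₁ - isotropic lam₂ mu₂) u₁ u₁) ∧
    ((∀ᵐ x ∂(volume.restrict Ω), lam₁ x ≤ lam₂ x) → (∀ x ∈ Ω, mu₁ x ≤ mu₂ x) →
      inner ℝ g (neumannToDirichlet Ω ΓD ΓN (isotropic lam₁ mu₁) g) ≥
        inner ℝ g (neumannToDirichlet Ω ΓD ΓN (isotropic lam₂ mu₂) g)) := by
  have hmu₁ := h₁.memLp_mu hΩ.isOpen
  have hmu₂ := h₂.memLp_mu hΩ.isOpen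
  have upper := inner_trace_sub_le_energy_sub h₁.memLp hmu₁ (h₁.lam_nonneg hα₁)
    (h₁.mu_nonneg hΩ.isOpen hβ₁) hu₁ hu₂
  have lower := inner_trace_sub_le_energy_sub h₂.memLp hmu₂ (h₂.lam_nonneg hα₁)
    (h₂.mu_nonneg hΩ.isOpen hβ₁) hu₂ hu₁
  rw [inner_neumannToDirichlet hu₁, inner_neumannToDirichlet hu₂,
    energy_isotropic_sub h₁.memLp hmu₁ h₂.memLp hmu₂,
    energy_isotropic_sub h₁.memLp hmu₁ h₂.memLp hmu₂]
  refine ⟨⟨upper, by linarith⟩, fun hlam hmu => ?_⟩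
  have mono := energy_self_mono h₁.memLp hmu₁ h₂.memLp hmu₂ hlam
    ((ae_restrict_mem hΩ.isOpen.measurableSet).mono hmu) u₂
  linarith
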